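/- An almost contact metric manifold $(M^{2n+1},g,\phi,\xi,\eta)$ is a smooth manifold (Hausdorff, second countable) of dimension $2n+1$ with a smooth Riemannian metric $g$, a smooth $(1,1)$-tensor field $\phi$, a smooth vector field $\xi$ and a smooth $1$-form $\eta$ such that $\phi^2=-\mathrm{id}+\xi\otimes\eta$, $\eta(X)=g(X,\xi)$, $g(\xi,\xi)=1$ and $g(\phi X,Y)=-g(X,\phi Y)$. Let $\nabla$ be the Levi-Civita connection of $g$ and $(\nabla_X\phi)Y=\nabla_X(\phi Y)-\phi(\nabla_XY)$. The manifold is called Sasakian if $(\nabla_X\phi)Y=g(X,Y)\xi-\eta(Y)X$ for all smooth vector fields $X,Y$, and nearly Sasakian if $(\nabla_X\phi)X=g(X,X)\xi-\eta(X)X$ for all smooth vector fields $X$. Theorem. On every nearly Sasakian manifold $(M,g,\phi,\xi,\eta)$, $$\nabla\phi=\xi\otimes g-\mathrm{id}\otimes\eta+\eta\otimes(\nabla_\xi\phi)-(\nabla_\xi\phi)\otimes\eta-\xi\otimes\big(g\circ\nabla_\xi\phi\big),$$ that is, for all smooth vector fields $X,Y$, $$(\nabla_X\phi)Y=g(X,Y)\xi-\eta(Y)X+\eta(X)(\nabla_\xi\phi)Y-\eta(Y)(\nabla_\xi\phi)X-g\big(X,(\nabla_\xi\phi)Y\big)\xi.$$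 Consequently, a nearly Sasakian manifold is Sasakian if and only if $\nabla_\xi\phi=0$. -/

import Mathlib

open Bundle Manifold
open scoped Manifold ContDiff Topology

noncomputable section

namespace RiemannianGeometry

variable {E : Type*} [NormedAddCommGroup E] [NormedSpace ℝ E]
  {H : Type*} [TopologicalSpace H] {I : ModelWithCorners ℝ E H}
  {M : Type*} [TopologicalSpace M] [ChartedSpace H M] [IsManifold I ∞ M]

/-- The function `x ↦ g_x (X x, Y x)`. -/
def pairing (g : ContMDiffRiemannianMetric I ∞ E (TangentSpace I : M → Type _))
    (X Y : Π x : M, TangentSpace I x) (x : M) : ℝ :=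
  g.inner x (X x) (Y x)

/-- Half of the right hand side of the Koszul formula: for differentiable vector fields,
`2 g(∇_X Y, Z) = X g(Y, Z) + Y g(Z, X) - Z g(X, Y) + g([X, Y], Z) - g([Y, Z], X) + g([Z, X], Y)`
where `∇` is the Levi-Civita connection of `g`. -/
def koszul (g : ContMDiffRiemannianMetric I ∞ E (TangentSpace I : M → Type _))
    (X Y Z : Π x : M, TangentSpace I x) (x : M) : ℝ :=
  (1 / 2 : ℝ) *
    (d% (pairing g Y Z) x (X x) + d% (pairing g Z X) x (Y x) - d% (pairing g X Y) x (Z x)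
      + g.inner x (VectorField.mlieBracket I X Y x) (Z x)
      - g.inner x (VectorField.mlieBracket I Y Z x) (X x)
      + g.inner x (VectorField.mlieBracket I Z X x) (Y x))

section Pairing

variable (g : ContMDiffRiemannianMetric I ∞ E (TangentSpace I : M → Type _))
  {X X' Y Y' Z : Π x : M, TangentSpace I x} {f : M → ℝ} {x : M}

lemma mdifferentiableAt_pairing (hX : MDiffAt (T% X) x) (hY : MDiffAt (T% Y) x) :
    MDiffAt (pairing g X Y) x := by
  have h := MDifferentiableAt.clm_bundle_apply₂ (F₁ := E) (F₂ := E) (F₃ := ℝ)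
    (E₃ := Bundle.Trivial M ℝ)
    (g.contMDiff.contMDiffAt (x := x) |>.mdifferentiableAt (by simp)) hX hY
  simp only [mdifferentiableAt_totalSpace] at h
  exact h.2

lemma pairing_comm (X Y : Π x : M, TangentSpace I x) : pairing g X Y = pairing g Y X := by
  ext x; exact g.symm x _ _

lemma d_pairing_add_left (hX : MDiffAt (T% X) x) (hX' : MDiffAt (T% X') x)
    (hY : MDiffAt (T% Y) x) :
    d% (pairing g (X + X') Y) x = d% (pairing g X Y) x + d% (pairing g X' Y) x := by
  rw [← mvfderiv_add (mdifferentiableAt_pairing g hX hY) (mdifferentiableAt_pairing g hX' hY)]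
  congr 1
  ext y; simp [pairing]

lemma d_pairing_smul_left (hf : MDiffAt f x) (hX : MDiffAt (T% X) x) (hY : MDiffAt (T% Y) x) :
    d% (pairing g (f • X) Y) x
      = f x • d% (pairing g X Y) x + pairing g X Y x • d% f x := by
  rw [← mvfderiv_mul hf (mdifferentiableAt_pairing g hX hY)]
  congr 1
  ext y; simp [pairing]

lemma d_pairing_add_right (hX : MDiffAt (T% X) x) (hX' : MDiffAt (T% X') x)
    (hY : MDiffAt (T% Y) x) :
    d% (pairing g Y (X + X')) x = d% (pairing g Y X) x + d% (pairing g Y X') x := by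
  simp only [pairing_comm g Y, d_pairing_add_left g hX hX' hY]

lemma d_pairing_smul_right (hf : MDiffAt f x) (hX : MDiffAt (T% X) x) (hY : MDiffAt (T% Y) x) :
    d% (pairing g Y (f • X)) x
      = f x • d% (pairing g Y X) x + pairing g Y X x • d% f x := by
  simp only [pairing_comm g Y, d_pairing_smul_left g hf hX hY]

end Pairing

section LeviCivita

variable [FiniteDimensional ℝ E]
  (g : ContMDiffRiemannianMetric I ∞ E (TangentSpace I : M → Type _))
  {X Y Y' Z : Π x : M, TangentSpace I x} {f : M → ℝ} {x : M}

open VectorField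

lemma koszul_tensorial_left (hY : MDiffAt (T% Y) x) (hZ : MDiffAt (T% Z) x) :
    TensorialAt I E (fun X ↦ koszul g X Y Z x) x where
  smul {f X} hf hX := by
    simp only [koszul, d_pairing_smul_left g hf hX hY, d_pairing_smul_right g hf hX hZ,
      mlieBracket_smul_left hf hX, mlieBracket_smul_right hf hX]
    simp [pairing, g.symm x (X x)]
    ring
  add {X X'} hX hX' := by
    simp only [koszul, d_pairing_add_left g hX hX' hY, d_pairing_add_right g hX hX' hZ,
      mlieBracket_add_left hX hX', mlieBracket_add_right hX hX']
    simp
    ring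

lemma koszul_tensorial_right (hX : MDiffAt (T% X) x) (hY : MDiffAt (T% Y) x) :
    TensorialAt I E (fun Z ↦ koszul g X Y Z x) x where
  smul {f Z} hf hZ := by
    simp only [koszul, d_pairing_smul_left g hf hZ hX, d_pairing_smul_right g hf hZ hY,
      mlieBracket_smul_left hf hZ, mlieBracket_smul_right hf hZ]
    simp [pairing, g.symm x (Z x)]
    ring
  add {Z Z'} hZ hZ' := by
    simp only [koszul, d_pairing_add_left g hZ hZ' hX, d_pairing_add_right g hZ hZ' hY,
      mlieBracket_add_left hZ hZ', mlieBracket_add_right hZ hZ']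
    simp
    ring

lemma koszul_add (hX : MDiffAt (T% X) x) (hY : MDiffAt (T% Y) x) (hY' : MDiffAt (T% Y') x)
    (hZ : MDiffAt (T% Z) x) :
    koszul g X (Y + Y') Z x = koszul g X Y Z x + koszul g X Y' Z x := by
  simp only [koszul, d_pairing_add_left g hY hY' hZ, d_pairing_add_right g hY hY' hX,
    mlieBracket_add_left hY hY', mlieBracket_add_right hY hY']
  simp
  ring

lemma koszul_leibniz (hX : MDiffAt (T% X) x) (hY : MDiffAt (T% Y) x) (hf : MDiffAt f x)
    (hZ : MDiffAt (T% Z) x) :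
    koszul g X (f • Y) Z x
      = f x * koszul g X Y Z x + d% f x (X x) * g.inner x (Y x) (Z x) := by
  simp only [koszul, d_pairing_smul_left g hf hY hZ, d_pairing_smul_right g hf hY hX,
    mlieBracket_smul_left hf hY, mlieBracket_smul_right hf hY]
  simp [pairing, g.symm x (Y x)]
  ring

/-- The bilinear form `g_x` on the tangent space at `x`. -/
def metricForm (x : M) : LinearMap.BilinForm ℝ (TangentSpace I x) :=
  ContinuousLinearMap.toLinearMap₁₂ (g.inner x)

set_option linter.unusedSectionVars false in
lemma metricForm_nondegenerate (x : M) : (metricForm g x).Nondegenerate := by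
  have key : ∀ v : TangentSpace I x, g.inner x v v = 0 → v = 0 := fun v hv ↦ by
    by_contra h
    exact (g.pos x v h).ne' hv
  exact ⟨fun v hv ↦ key v (hv v), fun v hv ↦ key v (hv v)⟩

lemma eq_of_inner_eq {x : M} {v w : TangentSpace I x}
    (h : ∀ u, g.inner x v u = g.inner x w u) : v = w :=
  sub_eq_zero.mp <| (metricForm_nondegenerate g x).1 (v - w) fun u ↦ by
    simp [metricForm, h u]

instance finiteDimensional_tangentSpace (x : M) : FiniteDimensional ℝ (TangentSpace I x) :=
  inferInstanceAs (FiniteDimensional ℝ E)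

instance t2Space_tangentSpace (x : M) :
    T2Space (TangentSpace I x) :=
  inferInstanceAs (T2Space E)

open Classical in
/-- The Levi-Civita derivative of a vector field `Y`: at a point `x` where `Y` is differentiable,
the endomorphism `u ↦ ∇_u Y` of the tangent space at `x` given by the Koszul formula
(and, by convention, `0` at the points where `Y` is not differentiable). -/
def leviCivitaFun (Y : Π x : M, TangentSpace I x) (x : M) :
    TangentSpace I x →L[ℝ] TangentSpace I x :=
  if hY : MDiffAt (T% Y) x then
    LinearMap.toContinuousLinearMap
      ((((metricForm g x).toDual (metricForm_nondegenerate g x)).symm.toLinearMap ∘ₗ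
        LinearMap.toContinuousLinearMap.symm.toLinearMap) ∘ₗ
        (TensorialAt.mkHom₂ (fun X Z ↦ koszul g X Y Z x) x
          (fun _ hZ ↦ koszul_tensorial_left g hY hZ)
          (fun _ hX ↦ koszul_tensorial_right g hX hY)).toLinearMap)
  else 0

/-- The Koszul formula. -/
lemma inner_leviCivitaFun (hX : MDiffAt (T% X) x) (hY : MDiffAt (T% Y) x)
    (hZ : MDiffAt (T% Z) x) :
    g.inner x (leviCivitaFun g Y x (X x)) (Z x) = koszul g X Y Z x := by
  rw [leviCivitaFun, dif_pos hY]
  refine (LinearMap.BilinForm.apply_toDual_symm_apply (B := metricForm g x)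
    (hB := metricForm_nondegenerate g x) (v := Z x) (f := _)).trans ?_
  exact TensorialAt.mkHom₂_apply (Φ := fun X Z ↦ koszul g X Y Z x)
    (fun _ hZ ↦ koszul_tensorial_left g hY hZ)
    (fun _ hX ↦ koszul_tensorial_right g hX hY) hX hZ

set_option linter.unusedSectionVars false in
/-- Tangent vectors extend to vector fields that are differentiable at the given point. -/
lemma exists_extension (v : TangentSpace I x) :
    ∃ Z : Π x : M, TangentSpace I x, MDiffAt (T% Z) x ∧ Z x = v :=
  ⟨FiberBundle.extend E v, FiberBundle.mdifferentiableAt_extend .., by simp⟩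

/-- The Levi-Civita connection of a Riemannian metric on a manifold. -/
def leviCivita : CovariantDerivative I E (TangentSpace I : M → Type _) where
  toFun := leviCivitaFun g
  isCovariantDerivativeOnUniv :=
    { add := fun {Y Y' x} hY hY' _ ↦ by
        ext u
        obtain ⟨X, hX, rfl⟩ := exists_extension u
        refine eq_of_inner_eq g fun w ↦ ?_
        obtain ⟨Z, hZ, rfl⟩ := exists_extension w
        rw [inner_leviCivitaFun g hX (mdifferentiableAt_add_section hY hY') hZ,
          koszul_add g hX hY hY' hZ]
        simp [inner_leviCivitaFun g hX hY hZ, inner_leviCivitaFun g hX hY' hZ]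
      leibniz := fun {Y f x} hY hf _ ↦ by
        ext u
        obtain ⟨X, hX, rfl⟩ := exists_extension u
        refine eq_of_inner_eq g fun w ↦ ?_
        obtain ⟨Z, hZ, rfl⟩ := exists_extension w
        rw [inner_leviCivitaFun g hX (hf.smul_section hY) hZ, koszul_leibniz g hX hY hf hZ]
        simp [inner_leviCivitaFun g hX hY hZ] }

/-- The Levi-Civita connection is compatible with the metric. -/
theorem leviCivita_metric (hX : MDiffAt (T% X) x) (hY : MDiffAt (T% Y) x)
    (hZ : MDiffAt (T% Z) x) :
    d% (pairing g Y Z) x (X x)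
      = g.inner x (leviCivita g Y x (X x)) (Z x) + g.inner x (Y x) (leviCivita g Z x (X x)) := by
  rw [g.symm x (Y x)]
  change _ = g.inner x (leviCivitaFun g Y x (X x)) (Z x)
    + g.inner x (leviCivitaFun g Z x (X x)) (Y x)
  rw [inner_leviCivitaFun g hX hY hZ, inner_leviCivitaFun g hX hZ hY, koszul, koszul,
    pairing_comm g Z Y, pairing_comm g Z X, pairing_comm g X Y,
    mlieBracket_swap_apply (V := Z) (W := Y),
    mlieBracket_swap_apply (V := X) (W := Z), mlieBracket_swap_apply (V := Y) (W := X)]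
  simp
  ring

/-- The Levi-Civita connection is torsion-free. -/
theorem leviCivita_torsion_free (hX : MDiffAt (T% X) x) (hY : MDiffAt (T% Y) x) :
    leviCivita g Y x (X x) - leviCivita g X x (Y x) = mlieBracket I X Y x := by
  refine eq_of_inner_eq g fun w ↦ ?_
  obtain ⟨Z, hZ, rfl⟩ := exists_extension w
  change g.inner x (leviCivitaFun g Y x (X x) - leviCivitaFun g X x (Y x)) (Z x) = _
  rw [map_sub, sub_apply, inner_leviCivitaFun g hX hY hZ,
    inner_leviCivitaFun g hY hX hZ, koszul, koszul,
    pairing_comm g Z Y, pairing_comm g Z X, pairing_comm g X Y,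
    mlieBracket_swap_apply (V := Z) (W := Y),
    mlieBracket_swap_apply (V := Z) (W := X), mlieBracket_swap_apply (V := Y) (W := X)]
  simp
  ring

end LeviCivita

/-- For a field of endomorphisms `φ` of the tangent bundle (a `(1,1)`-tensor field) and vector
fields `X`, `Y`, the vector field `(∇_X φ) Y = ∇_X (φ Y) - φ (∇_X Y)`, where `∇` is the
Levi-Civita connection of `g`. -/
def covDerivEnd [FiniteDimensional ℝ E]
    (g : ContMDiffRiemannianMetric I ∞ E (TangentSpace I : M → Type _))
    (φ : Π x : M, TangentSpace I x →L[ℝ] TangentSpace I x)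
    (X Y : Π x : M, TangentSpace I x) (x : M) : TangentSpace I x :=
  leviCivita g (fun y ↦ φ y (Y y)) x (X x) - φ x (leviCivita g Y x (X x))

/-- A smooth vector field on `M`. -/
def IsSmoothVectorField (X : Π x : M, TangentSpace I x) : Prop :=
  ContMDiff I (I.prod 𝓘(ℝ, E)) ∞ (fun x ↦ TotalSpace.mk' E x (X x))

variable (I M) in
/-- An almost contact metric structure `(g, φ, ξ, η)` on the manifold `M`: a smooth Riemannian
metric, a smooth `(1,1)`-tensor field, a smooth vector field and a smooth `1`-form with
`φ² = -id + ξ ⊗ η`, `η = g(·, ξ)`, `g(ξ, ξ) = 1`, and `φ` skew-symmetric with respect to `g`. -/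
structure AlmostContactMetricStructure where
  g : ContMDiffRiemannianMetric I ∞ E (TangentSpace I : M → Type _)
  φ : Π x : M, TangentSpace I x →L[ℝ] TangentSpace I x
  ξ : Π x : M, TangentSpace I x
  η : Π x : M, TangentSpace I x →L[ℝ] ℝ
  smooth_φ : ContMDiff I (I.prod 𝓘(ℝ, E →L[ℝ] E)) ∞
    (fun x ↦ TotalSpace.mk' (E →L[ℝ] E)
      (E := fun x : M ↦ TangentSpace I x →L[ℝ] TangentSpace I x) x (φ x))
  smooth_ξ : IsSmoothVectorField ξ
  smooth_η : ContMDiff I (I.prod 𝓘(ℝ, E →L[ℝ] ℝ)) ∞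
    (fun x ↦ TotalSpace.mk' (E →L[ℝ] ℝ)
      (E := fun x : M ↦ TangentSpace I x →L[ℝ] Bundle.Trivial M ℝ x) x (η x))
  φ_sq : ∀ (x : M) (v : TangentSpace I x), φ x (φ x v) = -v + η x v • ξ x
  η_eq : ∀ (x : M) (v : TangentSpace I x), η x v = g.inner x v (ξ x)
  inner_ξ_ξ : ∀ x : M, g.inner x (ξ x) (ξ x) = 1
  φ_skew : ∀ (x : M) (v w : TangentSpace I x), g.inner x (φ x v) w = -g.inner x v (φ x w)

namespace AlmostContactMetricStructure

variable [FiniteDimensional ℝ E] (S : AlmostContactMetricStructure I M)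

/-- `(M, g, φ, ξ, η)` is Sasakian: `(∇_X φ) Y = g(X, Y) ξ - η(Y) X` for all vector fields. -/
def IsSasakian : Prop :=
  ∀ X Y : Π x : M, TangentSpace I x, IsSmoothVectorField X → IsSmoothVectorField Y →
    ∀ x : M, covDerivEnd S.g S.φ X Y x
      = S.g.inner x (X x) (Y x) • S.ξ x - S.η x (Y x) • X x

/-- `(M, g, φ, ξ, η)` is nearly Sasakian: `(∇_X φ) X = g(X, X) ξ - η(X) X` for all vector
fields. -/
def IsNearlySasakian : Prop :=
  ∀ X : Π x : M, TangentSpace I x, IsSmoothVectorField X →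
    ∀ x : M, covDerivEnd S.g S.φ X X x
      = S.g.inner x (X x) (X x) • S.ξ x - S.η x (X x) • X x

end AlmostContactMetricStructure

end RiemannianGeometry

end

/-! Put T(X,Y) = (∇_Xφ)Y − g(X,Y)ξ + η(Y)X and A = T(ξ,·) = ∇_ξφ. Polarizing the nearly Sasakian
condition makes T skew, and skewness of φ then makes τ(X,Y,Z) = g(T(X,Y),Z) a 3-form. The formula
says that τ is determined by A, that is, τ vanishes on vectors orthogonal to ξ (`hor_T`); splitting
X and Y along ξ gives `T_eq`.

Let h = ∇ξ + φ = −φA, which is skew and anticommutes with φ. Since dη is closed and the 2-form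
g(φ·,·) has differential 3τ, the cyclic sum of g((∇_X h)Y,Z) on horizontal fields is 3τ
(`cyclic_P`). Moreover ξ is Killing and L_ξφ = 3A, so commuting d with L_ξ gives L_ξτ = d(g(A·,·))
(`LT_eq_cyclic`). Combined with the derivative of hφ = −φh (`P_φ`), with the fact that φ moves
between horizontal slots of τ (`g_T_φ`), and with its Lie derivative (`LT_φ`), linear elimination
yields τ(X,Y,hZ) = 0 (`g_T_h`).

Hence the horizontal part of T takes values in ker h. On ker h the terms g((∇_X h)Y,Z) vanish, so τ
does too; pairing T(X,Y) with its own horizontal part then removes the assumption of lying in ker h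
slot by slot. This is algebra over the ring of smooth functions, with global fields only; no
eigenspaces or constant rank of h are needed. -/

/-- The algebraic data of a Levi-Civita connection: a module `L` of vector fields over a ring `R`
of functions, with the derivations `D X`, the metric `g` and the connection `nabla`. The bracket is
`nabla X Y - nabla Y X`. -/
structure LeviCivitaModule (R L : Type*) [CommRing R] [AddCommGroup L] [Module R L] where
  D : L → R →+ R
  g : L →ₗ[R] L →ₗ[R] R
  nabla : L →ₗ[R] L →+ L
  g_comm : ∀ X Y, g X Y = g Y X
  eq_zero_of_g_self : ∀ X, g X X = 0 → X = 0
  leibniz : ∀ X f Y, nabla X (f • Y) = D X f • Y + f • nabla X Y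
  D_g : ∀ X Y Z, D X (g Y Z) = g (nabla X Y) Z + g Y (nabla X Z)
  jacobi : ∀ X Y Z,
    nabla X (nabla Y Z - nabla Z Y) - nabla (nabla Y Z - nabla Z Y) X
      = nabla (nabla X Y - nabla Y X) Z - nabla Z (nabla X Y - nabla Y X)
        + (nabla Y (nabla X Z - nabla Z X) - nabla (nabla X Z - nabla Z X) Y)

/-- The algebraic data of a nearly Sasakian structure. -/
structure NearlySasakianModule (R L : Type*) [CommRing R] [AddCommGroup L] [Module R L] extends
    LeviCivitaModule R L where
  φ : L →ₗ[R] L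
  ξ : L
  φ_φ : ∀ X, φ (φ X) = -X + g X ξ • ξ
  g_ξ_ξ : g ξ ξ = 1
  g_φ : ∀ X Y, g (φ X) Y = -g X (φ Y)
  nearly : ∀ X, nabla X (φ X) - φ (nabla X X) = g X X • ξ - g X ξ • X

/-! ### Bracket, exterior derivative and Lie derivative in the algebraic model -/

namespace LeviCivitaModule

variable {R L : Type*} [CommRing R] [AddCommGroup L] [Module R L] (S : LeviCivitaModule R L)

/-- The bracket determined by a torsion-free connection. -/
def br (X Y : L) : L := S.nabla X Y - S.nabla Y X

lemma ext_g {X Y : L} (h : ∀ Z, S.g X Z = S.g Y Z) : X = Y :=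
  sub_eq_zero.mp <| S.eq_zero_of_g_self _ <| by
    rw [S.g.map_sub, LinearMap.sub_apply, h, sub_self]

lemma br_add_right (X Y Z : L) : S.br X (Y + Z) = S.br X Y + S.br X Z := by
  simp only [br, map_add, AddMonoidHom.add_apply]; abel

lemma br_swap (X Y : L) : S.br X Y = -S.br Y X := by simp [br]

lemma br_smul (X Y : L) (f : R) : S.br X (f • Y) = S.D X f • Y + f • S.br X Y := by
  simp only [br, S.leibniz, map_smul, AddMonoidHom.smul_apply, smul_sub]; abel

lemma br_jacobi (X Y Z : L) :
    S.br X (S.br Y Z) = S.br (S.br X Y) Z + S.br Y (S.br X Z) := S.jacobi X Y Z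

lemma D_one_smul (X Y : L) : S.D X 1 • Y = 0 := by
  simpa using S.leibniz X 1 Y

/-- The maps `D X` are only assumed additive, so their commutator is recovered from the Jacobi
identity for X, Y, fZ after cancelling f times the one for X, Y, Z. -/
lemma D_br_smul (X Y Z : L) (f : R) :
    (S.D (S.br X Y) f) • Z = (S.D X (S.D Y f) - S.D Y (S.D X f)) • Z := by
  have h := S.br_jacobi X Y (f • Z)
  rw [S.br_smul Y, S.br_smul X, S.br_smul (S.br X Y), S.br_add_right, S.br_add_right,
    S.br_smul, S.br_smul, S.br_smul, S.br_smul, S.br_jacobi X Y Z, smul_add] at h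
  rw [sub_smul]
  linear_combination (norm := module) -h

lemma br_br_cyclic (X Y Z : L) :
    S.br (S.br X Y) Z + S.br (S.br Y Z) X + S.br (S.br Z X) Y = 0 := by
  have h1 := S.br_jacobi X Y Z
  have h2 : S.br Y (S.br X Z) = S.br (S.br Z X) Y := by
    rw [S.br_swap X Z, S.br_swap Y, S.br_swap (S.br Z X)]
    simp only [br, map_neg, AddMonoidHom.neg_apply]; abel
  rw [S.br_swap X, h2] at h1
  linear_combination (norm := module) -h1

/-- The exterior derivative of a `2`-form. -/
def extDeriv (Ω : L → L → R) (X Y Z : L) : R :=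
  S.D X (Ω Y Z) - Ω (S.br X Y) Z + (S.D Y (Ω Z X) - Ω (S.br Y Z) X)
    + (S.D Z (Ω X Y) - Ω (S.br Z X) Y)

/-- The Lie derivative of a `2`-form. -/
def lieDeriv (V : L) (Ω : L → L → R) (X Y : L) : R :=
  S.D V (Ω X Y) - Ω (S.br V X) Y - Ω X (S.br V Y)

end LeviCivitaModule

lemma eq_zero_of_natCast_mul {R : Type*} [CommRing R] [IsAddTorsionFree R] {n : ℕ} (hn : n ≠ 0)
    {a : R} (h : n * a = 0) : a = 0 := by
  rw [← nsmul_eq_mul] at h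
  exact (nsmul_eq_zero_iff_right hn).mp h

/-! ### The 3-form g(T(X,Y),Z) and the endomorphisms A and h -/

namespace NearlySasakianModule

variable {R L : Type*} [CommRing R] [AddCommGroup L] [Module R L] (S : NearlySasakianModule R L)

/-- Pairing with the unit field ξ strips the vector from `D_br_smul`. -/
lemma D_br (X Y : L) (f : R) :
    S.D (S.br X Y) f = S.D X (S.D Y f) - S.D Y (S.D X f) := by
  have h := congrArg (S.g · S.ξ) (S.D_br_smul X Y S.ξ f)
  simpa [S.g_ξ_ξ] using h

lemma D_one (X : L) : S.D X 1 = 0 := by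
  have h := congrArg (S.g · S.ξ) (S.D_one_smul X S.ξ)
  simpa [S.g_ξ_ξ] using h

lemma φ_ξ : S.φ S.ξ = 0 := by
  apply S.eq_zero_of_g_self
  rw [S.g_φ, S.φ_φ, S.g_ξ_ξ]; simp

lemma g_φ_ξ (X : L) : S.g (S.φ X) S.ξ = 0 := by rw [S.g_φ, S.φ_ξ]; simp

/-- The tensor `(∇_X φ) Y - g(X, Y) ξ + η(Y) X`, which vanishes for Sasakian structures. -/
def T : L →ₗ[R] L →+ L where
  toFun X := AddMonoidHom.mk' (fun Y ↦ S.nabla X (S.φ Y) - S.φ (S.nabla X Y) - S.g X Y • S.ξ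
      + S.g Y S.ξ • X) fun Y Z ↦ by
    simp only [map_add, LinearMap.add_apply, add_smul]; abel
  map_add' X Y := by
    ext Z
    simp only [map_add, LinearMap.add_apply, add_smul, smul_add, AddMonoidHom.mk'_apply,
      AddMonoidHom.add_apply]
    abel
  map_smul' f X := by
    ext Z
    simp only [map_smul, LinearMap.smul_apply, AddMonoidHom.mk'_apply, AddMonoidHom.smul_apply,
      RingHom.id_apply, smul_eq_mul]
    module

lemma nabla_φ (X Y : L) :
    S.nabla X (S.φ Y) = S.T X Y + S.φ (S.nabla X Y) + S.g X Y • S.ξ - S.g Y S.ξ • X := by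
  simp only [T, LinearMap.coe_mk, AddHom.coe_mk, AddMonoidHom.mk'_apply]; abel

lemma T_self (X : L) : S.T X X = 0 := by
  have := S.nearly X
  simp only [S.nabla_φ] at this
  linear_combination (norm := module) this

lemma T_swap (X Y : L) : S.T X Y = -S.T Y X := by
  have := S.T_self (X + Y)
  simp only [map_add, AddMonoidHom.add_apply, S.T_self] at this
  rw [eq_neg_iff_add_eq_zero]
  simpa [add_comm] using this

/-- Skewness transports linearity from the first slot, so no Leibniz computation is needed. -/
lemma T_smul (X Y : L) (f : R) : S.T X (f • Y) = f • S.T X Y := by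
  rw [T_swap, map_smul, AddMonoidHom.smul_apply, S.T_swap X Y, smul_neg]

/-- ∇_Xφ is skew because φ is skew and ∇ is metric; the correction terms in T are skew as well. With
`T_swap` this makes g(T(X,Y),Z) alternating. -/
lemma g_T_right (X Y Z : L) : S.g (S.T X Y) Z = -S.g (S.T X Z) Y := by
  have h1 := S.D_g X (S.φ Y) Z
  have h2 := S.D_g X (S.φ Z) Y
  simp only [S.nabla_φ, map_add, map_sub, LinearMap.add_apply, LinearMap.sub_apply, map_smul,
    LinearMap.smul_apply, smul_eq_mul] at h1 h2
  have h3 : S.D X (S.g (S.φ Y) Z) = -S.D X (S.g (S.φ Z) Y) := by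
    rw [S.g_φ, S.g_comm Y, map_neg]
  linear_combination h3 - h1 - h2 - S.g_φ (S.nabla X Y) Z - S.g_φ (S.nabla X Z) Y
    + S.g_comm (S.nabla X Y) (S.φ Z) + S.g_comm (S.nabla X Z) (S.φ Y)
    - S.g X Y * S.g_comm S.ξ Z - S.g X Z * S.g_comm S.ξ Y

lemma g_T_rotate (X Y Z : L) : S.g (S.T X Y) Z = S.g (S.T Y Z) X := by
  rw [S.g_T_right Y, S.T_swap Y]; simp

/-- The covariant derivative of `φ` in the direction `ξ`. -/
def A : L →ₗ[R] L where
  toFun := S.T S.ξ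
  map_add' := map_add _
  map_smul' f X := S.T_smul _ X f

lemma T_ξ (X : L) : S.T S.ξ X = S.A X := rfl

lemma T_ξ_right (X : L) : S.T X S.ξ = -S.A X := S.T_swap _ _

lemma A_ξ : S.A S.ξ = 0 := S.T_self _

lemma g_A (X Y : L) : S.g (S.A X) Y = -S.g X (S.A Y) := by
  rw [← T_ξ, g_T_right, S.g_comm X]; rfl

lemma g_A_ξ (X : L) : S.g (S.A X) S.ξ = 0 := by simp [g_A, A_ξ]

/-- The endomorphism `∇ξ + φ`. -/
def h : L →ₗ[R] L := -(S.φ ∘ₗ S.A)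

lemma φ_A (X : L) : S.φ (S.A X) = -S.h X := by simp [h]

lemma φ_h (X : L) : S.φ (S.h X) = S.A X := by simp [h, φ_φ, g_A_ξ]

lemma h_ξ : S.h S.ξ = 0 := by simp [h, A_ξ]

lemma g_h_ξ (X : L) : S.g (S.h X) S.ξ = 0 := by simp [h, g_φ_ξ]

/-- This is the covariant derivative of φ² = −id + ξ⊗η. -/
lemma T_φ_aux (X Y : L) : S.T X (S.φ Y) + S.φ (S.T X Y) =
    -S.g X (S.φ Y) • S.ξ + S.g Y S.ξ • S.φ X + S.g Y (S.nabla X S.ξ) • S.ξ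
      + S.g Y S.ξ • S.nabla X S.ξ := by
  have h1 := S.nabla_φ X (S.φ Y)
  have h2 := congrArg S.φ (S.nabla_φ X Y)
  have h3 := S.D_g X Y S.ξ
  rw [S.φ_φ, map_add, S.leibniz, h3, g_φ_ξ] at h1
  simp only [map_add, map_sub, map_neg, map_smul, φ_φ, φ_ξ] at h1 h2
  linear_combination (norm := module) -h1 - h2

/-- Cartan's relation d L_V = L_V d; it rests on the Jacobi identity and on `D_br`. -/
lemma extDeriv_lieDeriv (V : L) (Ω : L → L → R)
    (hΩ : ∀ X Y Z, Ω (X + Y) Z = Ω X Z + Ω Y Z) (X Y Z : L) :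
    S.extDeriv (S.lieDeriv V Ω) X Y Z = S.D V (S.extDeriv Ω X Y Z)
      - S.extDeriv Ω (S.br V X) Y Z - S.extDeriv Ω X (S.br V Y) Z
      - S.extDeriv Ω X Y (S.br V Z) := by
  simp only [LeviCivitaModule.extDeriv, LeviCivitaModule.lieDeriv, map_sub, map_add, D_br,
    S.br_jacobi V, hΩ]
  ring

/-- The non-T terms of ∇φ cancel in the cyclic sum, and the three remaining terms agree by total
skewness. -/
lemma extDeriv_g_φ (X Y Z : L) :
    S.extDeriv (fun X Y ↦ S.g (S.φ X) Y) X Y Z = 3 * S.g (S.T X Y) Z := by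
  have h1 (X Y Z : L) : S.D X (S.g (S.φ Y) Z) = S.g (S.T X Y) Z + S.g (S.φ (S.nabla X Y)) Z
      + S.g X Y * S.g Z S.ξ - S.g Y S.ξ * S.g X Z - S.g (S.φ (S.nabla X Z)) Y := by
    rw [S.D_g, nabla_φ, S.g_comm Z S.ξ, S.g_comm (S.φ Y), S.g_φ (S.nabla X Z)]
    simp only [map_add, map_sub, LinearMap.add_apply, LinearMap.sub_apply, map_smul,
      LinearMap.smul_apply, smul_eq_mul]
    ring
  simp only [LeviCivitaModule.extDeriv, LeviCivitaModule.br, map_sub, LinearMap.sub_apply, h1]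
  rw [S.g_T_rotate X Y, S.g_T_rotate Y Z, S.g_comm Y X, S.g_comm Z X, S.g_comm Z Y]
  ring

/-- `g((∇_X h) Y, Z)`. -/
def P (X Y Z : L) : R := S.g (S.nabla X (S.h Y) - S.h (S.nabla X Y)) Z

lemma P_neg (X Y Z : L) : S.P (-X) Y Z = -S.P X Y Z ∧ S.P X (-Y) Z = -S.P X Y Z ∧
    S.P X Y (-Z) = -S.P X Y Z := by
  refine ⟨?_, ?_, ?_⟩ <;> simp only [P, map_neg, map_sub, AddMonoidHom.neg_apply,
    LinearMap.neg_apply, LinearMap.sub_apply] <;> ring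

/-- The component of a vector field orthogonal to `ξ`. -/
def hor (X : L) : L := X - S.g X S.ξ • S.ξ

lemma g_hor_ξ (X : L) : S.g (S.hor X) S.ξ = 0 := by
  simp [hor, g_ξ_ξ]

lemma g_hor {X Y : L} (hY : S.g Y S.ξ = 0) : S.g (S.hor X) Y = S.g X Y := by
  simp [hor, S.g_comm S.ξ, hY]

variable [IsAddTorsionFree R]

lemma g_nabla_ξ_ξ (X : L) : S.g (S.nabla X S.ξ) S.ξ = 0 := by
  have h1 := S.D_g X S.ξ S.ξ
  rw [g_ξ_ξ, D_one, S.g_comm S.ξ] at h1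
  exact eq_zero_of_natCast_mul two_ne_zero (by push_cast; linear_combination -h1)

/-- Taking Y = ξ in `T_φ_aux` isolates ∇_Xξ, since φξ = 0 and ∇_Xξ is orthogonal to ξ. -/
lemma nabla_ξ (X : L) : S.nabla X S.ξ = -S.φ X + S.h X := by
  have h1 := S.T_φ_aux X S.ξ
  rw [S.g_comm S.ξ (S.nabla _ _), g_nabla_ξ_ξ, S.T_ξ_right, φ_ξ, map_neg, φ_A, g_ξ_ξ] at h1
  simp only [map_zero] at h1
  linear_combination (norm := module) -h1

lemma T_φ (X Y : L) :
    S.T X (S.φ Y) = -S.φ (S.T X Y) + S.g Y (S.h X) • S.ξ + S.g Y S.ξ • S.h X := by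
  have h1 := S.T_φ_aux X Y
  simp only [nabla_ξ, map_add, map_neg] at h1
  rw [S.g_comm Y (S.φ X), S.g_φ] at h1
  linear_combination (norm := module) h1

lemma A_φ (X : L) : S.A (S.φ X) = S.h X := by
  have h1 := S.T_φ S.ξ X
  simpa [T_ξ, h_ξ, φ_A] using h1

lemma h_φ (X : L) : S.h (S.φ X) = -S.A X := by
  rw [← A_φ, φ_φ, map_add, map_smul, A_ξ]; simp

lemma g_h (X Y : L) : S.g (S.h X) Y = -S.g X (S.h Y) := by
  rw [← A_φ, g_A, g_φ, φ_A]; simp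

lemma g_nabla_ξ (X Y : L) : S.g (S.nabla X S.ξ) Y = -S.g (S.nabla Y S.ξ) X := by
  simp only [nabla_ξ, map_add, map_neg, LinearMap.add_apply, LinearMap.neg_apply]
  rw [S.g_h X, S.g_φ X, S.g_comm X, S.g_comm X]; ring

lemma P_swap (X Y Z : L) : S.P X Y Z = -S.P X Z Y := by
  have h1 := S.D_g X (S.h Y) Z
  have h2 := S.D_g X (S.h Z) Y
  have h3 : S.D X (S.g (S.h Y) Z) = -S.D X (S.g (S.h Z) Y) := by
    rw [S.g_h, S.g_comm Y, map_neg]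
  simp only [P, map_sub, LinearMap.sub_apply]
  linear_combination h3 - h1 - h2 - S.g_h (S.nabla X Y) Z - S.g_h (S.nabla X Z) Y
    + S.g_comm (S.nabla X Y) (S.h Z) + S.g_comm (S.nabla X Z) (S.h Y)

/-- The covariant derivative of hφ = −φh, paired with a horizontal field. -/
lemma P_φ (X Y Z : L) (hY : S.g Y S.ξ = 0) (hZ : S.g Z S.ξ = 0) :
    S.P X (S.φ Y) Z - S.P X Y (S.φ Z) = S.g (S.T X Y) (S.h Z) - S.g (S.T X (S.h Y)) Z := by
  have h1 := S.nabla_φ X Y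
  have h2 := S.nabla_φ X (S.h Y)
  have h3 : S.nabla X (S.h (S.φ Y)) = -S.nabla X (S.φ (S.h Y)) := by
    rw [h_φ, φ_h, map_neg]
  have h4 := S.h_φ (S.nabla X Y)
  simp only [P, h3, h1, h2, map_add, map_sub, map_neg, map_smul, h_ξ, LinearMap.add_apply,
    LinearMap.sub_apply, LinearMap.neg_apply, h4, hY, g_h_ξ, smul_zero, zero_smul, map_zero,
    LinearMap.zero_apply, LinearMap.smul_apply, smul_eq_mul, S.g_comm S.ξ, hZ]
  rw [S.g_φ (S.nabla _ _), S.g_h (S.T _ _), ← φ_h, S.g_φ]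
  ring

/-! ### Closedness of dη and the cyclic identity for ∇h -/

lemma two_mul_g_nabla_ξ (X Y : L) : 2 * S.g (S.nabla X S.ξ) Y =
    S.D X (S.g Y S.ξ) - S.D Y (S.g X S.ξ) - S.g (S.br X Y) S.ξ := by
  rw [S.D_g, S.D_g, LeviCivitaModule.br, map_sub, LinearMap.sub_apply, S.g_comm Y, S.g_comm X,
    S.g_nabla_ξ Y X]
  ring

/-- By `two_mul_g_nabla_ξ` the form is half of dη, so this is d² = 0. -/
lemma extDeriv_g_nabla_ξ (X Y Z : L) :
    S.extDeriv (fun X Y ↦ S.g (S.nabla X S.ξ) Y) X Y Z = 0 := by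
  refine eq_zero_of_natCast_mul two_ne_zero ?_
  have hD (U V W : L) : 2 * S.D U (S.g (S.nabla V S.ξ) W)
      = S.D U (S.D V (S.g W S.ξ)) - S.D U (S.D W (S.g V S.ξ)) - S.D U (S.g (S.br V W) S.ξ) := by
    rw [← map_sub, ← map_sub, ← two_mul_g_nabla_ξ, two_mul, two_mul, map_add]
  have hJ := congrArg (S.g · S.ξ) (S.br_br_cyclic X Y Z)
  simp only [map_add, LinearMap.add_apply, map_zero, LinearMap.zero_apply] at hJ
  simp only [LeviCivitaModule.extDeriv]
  push_cast
  linear_combination hD X Y Z + hD Y Z X + hD Z X Y - S.two_mul_g_nabla_ξ (S.br X Y) Z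
    - S.two_mul_g_nabla_ξ (S.br Y Z) X - S.two_mul_g_nabla_ξ (S.br Z X) Y + hJ
    - S.D_br X Y (S.g Z S.ξ) - S.D_br Y Z (S.g X S.ξ) - S.D_br Z X (S.g Y S.ξ)

lemma nabla_h (X Y : L) : S.nabla X (S.h Y) =
    S.nabla X (S.nabla Y S.ξ) + S.nabla X (S.φ Y) := by
  rw [S.nabla_ξ Y, ← map_add]; congr 1; abel

/-- Since h = ∇ξ + φ, the closed form g(∇ξ·,·) drops out and each term leaves one copy of
g(T(X,Y),Z). -/
lemma cyclic_P (X Y Z : L) (hX : S.g X S.ξ = 0) (hY : S.g Y S.ξ = 0) (hZ : S.g Z S.ξ = 0) :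
    S.P X Y Z + S.P Y Z X + S.P Z X Y = 3 * S.g (S.T X Y) Z := by
  have hP (X Y Z : L) (hY : S.g Y S.ξ = 0) (hZ : S.g Z S.ξ = 0) :
      S.P X Y Z = S.D X (S.g (S.nabla Y S.ξ) Z) - S.g (S.nabla (S.nabla X Y) S.ξ) Z
        + S.g (S.nabla (S.nabla X Z) S.ξ) Y + S.g (S.T X Y) Z := by
    rw [P, nabla_h, nabla_φ, hY, S.D_g, S.g_nabla_ξ _ Y,
      S.nabla_ξ (S.nabla X Y)]
    simp only [map_add, map_sub, map_neg, LinearMap.add_apply, LinearMap.sub_apply, map_smul,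
      LinearMap.smul_apply, smul_eq_mul, LinearMap.neg_apply, S.g_comm S.ξ, hZ, zero_smul, map_zero,
      LinearMap.zero_apply]
    ring
  have hd := S.extDeriv_g_nabla_ξ X Y Z
  simp only [LeviCivitaModule.extDeriv, LeviCivitaModule.br, map_sub, LinearMap.sub_apply,
    AddMonoidHom.sub_apply] at hd
  rw [hP X Y Z hY hZ, hP Y Z X hZ hX, hP Z X Y hX hY]
  rw [S.g_T_rotate X Y, S.g_T_rotate Y Z]
  linear_combination hd

/-! ### Lie derivatives along ξ -/

/-- One copy of A comes from ∇_ξφ, the other two from φh − hφ = 2A, the commutator of φ with ∇ξ. -/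
lemma br_ξ_φ (X : L) : S.br S.ξ (S.φ X) = S.φ (S.br S.ξ X) + 3 • S.A X := by
  simp only [LeviCivitaModule.br, nabla_φ, T_ξ, nabla_ξ, h_φ, map_sub, map_add, map_neg, φ_h,
    S.g_comm S.ξ]
  module

/-- ξ is Killing because ∇ξ is skew. -/
lemma D_ξ_g (X Y : L) : S.D S.ξ (S.g X Y) = S.g (S.br S.ξ X) Y + S.g X (S.br S.ξ Y) := by
  rw [S.D_g, LeviCivitaModule.br, LeviCivitaModule.br, map_sub, map_sub, LinearMap.sub_apply,
    S.g_comm X (S.nabla Y S.ξ), S.g_nabla_ξ Y]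
  ring

lemma g_br_ξ {X : L} (hX : S.g X S.ξ = 0) : S.g (S.br S.ξ X) S.ξ = 0 := by
  have h1 := S.D_ξ_g X S.ξ
  simp only [LeviCivitaModule.br, sub_self, map_zero, hX, add_zero] at h1 ⊢
  exact h1.symm

lemma lieDeriv_ξ_g_φ :
    S.lieDeriv S.ξ (fun X Y ↦ S.g (S.φ X) Y) = fun X Y ↦ 3 * S.g (S.A X) Y := by
  ext X Y
  rw [LeviCivitaModule.lieDeriv, D_ξ_g, br_ξ_φ, map_add, LinearMap.add_apply, map_nsmul,
    LinearMap.smul_apply, nsmul_eq_mul]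
  push_cast; ring

/-- The Lie derivative along `ξ` of the `3`-form `g(T(X, Y), Z)`. -/
def LT (X Y Z : L) : R := S.D S.ξ (S.g (S.T X Y) Z) - S.g (S.T (S.br S.ξ X) Y) Z
  - S.g (S.T X (S.br S.ξ Y)) Z - S.g (S.T X Y) (S.br S.ξ Z)

/-- Applying d L_ξ = L_ξ d to g(φ·,·) gives L_ξτ = d(g(A·,·)); writing A = φh expresses the right
side through ∇h. -/
lemma LT_eq_cyclic (X Y Z : L) (hX : S.g X S.ξ = 0) (hY : S.g Y S.ξ = 0) (hZ : S.g Z S.ξ = 0) :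
    S.LT X Y Z = S.g (S.T X (S.h Y)) Z - S.P X Y (S.φ Z) + (S.g (S.T Y (S.h Z)) X - S.P Y Z (S.φ X))
      + (S.g (S.T Z (S.h X)) Y - S.P Z X (S.φ Y)) := by
  have h1 (X Y Z : L) (hZ : S.g Z S.ξ = 0) : S.D X (S.g (S.A Y) Z) = S.g (S.T X (S.h Y)) Z
      - S.P X Y (S.φ Z) + S.g (S.A (S.nabla X Y)) Z - S.g (S.A (S.nabla X Z)) Y := by
    rw [P, ← neg_eq_iff_eq_neg.mpr (S.g_φ _ Z), S.D_g, S.g_comm (S.A Y), S.g_A (S.nabla X Z),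
      ← S.φ_h Y, S.nabla_φ, map_sub S.φ, S.φ_h (S.nabla X Y), g_h_ξ]
    simp only [map_add, map_sub, LinearMap.add_apply, LinearMap.sub_apply, map_smul,
      LinearMap.smul_apply, smul_eq_mul, S.g_comm S.ξ, hZ]
    ring
  have h2 := S.extDeriv_lieDeriv S.ξ (fun X Y ↦ S.g (S.φ X) Y) (by simp) X Y Z
  have h3 (X : L) (a : R) : S.D X (3 * a) = 3 * S.D X a := by
    rw [show 3 * a = a + a + a by ring, map_add, map_add]; ring
  rw [lieDeriv_ξ_g_φ] at h2
  simp only [extDeriv_g_φ] at h2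
  simp only [LeviCivitaModule.extDeriv, h3] at h2
  rw [h1 X Y Z hZ, h1 Y Z X hX, h1 Z X Y hY] at h2
  simp only [LeviCivitaModule.br, map_sub, LinearMap.sub_apply] at h2
  refine sub_eq_zero.mp (eq_zero_of_natCast_mul three_ne_zero ?_)
  simp only [LT, LeviCivitaModule.br, map_sub, LinearMap.sub_apply]
  push_cast
  linear_combination -h2

lemma g_T_φ (X Y Z : L) (hY : S.g Y S.ξ = 0) (hZ : S.g Z S.ξ = 0) :
    S.g (S.T X (S.φ Y)) Z = S.g (S.T X Y) (S.φ Z) := by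
  rw [T_φ, hY, zero_smul, add_zero, map_add, LinearMap.add_apply, map_neg, LinearMap.neg_apply,
    S.g_φ, map_smul, LinearMap.smul_apply, S.g_comm S.ξ, hZ]
  simp

/-- This is L_ξ applied to `g_T_φ`; the right side is the contribution of L_ξφ = 3A. -/
lemma LT_φ (X Y Z : L) (hY : S.g Y S.ξ = 0) (hZ : S.g Z S.ξ = 0) :
    S.LT X (S.φ Y) Z - S.LT X Y (S.φ Z)
      = 3 * (S.g (S.T X Y) (S.A Z) - S.g (S.T X (S.A Y)) Z) := by
  rw [LT, LT, br_ξ_φ, br_ξ_φ, g_T_φ _ _ _ _ hY hZ, g_T_φ _ _ _ _ hY hZ,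
    g_T_φ _ _ _ _ hY (S.g_br_ξ hZ)]
  simp only [map_add, LinearMap.add_apply, map_nsmul, LinearMap.smul_apply, nsmul_eq_mul,
    g_T_φ _ _ _ _ (S.g_br_ξ hY) hZ]
  push_cast; ring

/-! ### Vanishing of the horizontal part of T -/

lemma g_T_φ_left (X Y Z : L) (hX : S.g X S.ξ = 0) (hZ : S.g Z S.ξ = 0) :
    S.g (S.T (S.φ X) Y) Z = S.g (S.T X Y) (S.φ Z) := by
  rw [S.g_T_rotate (S.φ X), ← S.g_T_φ Y Z X hZ hX, S.g_T_rotate X]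

/-- Rewriting rules to a normal form: arguments in a fixed order, φ in the last slot. -/
lemma g_T_perm (X Y Z : L) (hX : S.g X S.ξ = 0) (hY : S.g Y S.ξ = 0) (hZ : S.g Z S.ξ = 0) :
    (S.g (S.T Y Z) X = S.g (S.T X Y) Z ∧ S.g (S.T Z X) Y = S.g (S.T X Y) Z) ∧
    (S.g (S.T Y X) Z = -S.g (S.T X Y) Z ∧ S.g (S.T X Z) Y = -S.g (S.T X Y) Z ∧
      S.g (S.T Z Y) X = -S.g (S.T X Y) Z) ∧
    (S.g (S.T Y Z) (S.φ X) = S.g (S.T X Y) (S.φ Z) ∧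
      S.g (S.T Z X) (S.φ Y) = S.g (S.T X Y) (S.φ Z)) ∧
    (S.g (S.T Y X) (S.φ Z) = -S.g (S.T X Y) (S.φ Z) ∧
      S.g (S.T X Z) (S.φ Y) = -S.g (S.T X Y) (S.φ Z) ∧
      S.g (S.T Z Y) (S.φ X) = -S.g (S.T X Y) (S.φ Z)) := by
  have h1 (X Y Z : L) : S.g (S.T Y X) Z = -S.g (S.T X Y) Z := by rw [S.T_swap]; simp
  have h2 (X Y Z : L) (hX : S.g X S.ξ = 0) (hZ : S.g Z S.ξ = 0) :
      S.g (S.T Y Z) (S.φ X) = S.g (S.T X Y) (S.φ Z) := by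
    rw [← S.g_T_φ Y Z X hZ hX, S.g_T_rotate X]
  have h3 := (S.g_T_rotate X Y Z).symm
  have h4 := S.g_T_rotate Z X Y
  have h5 := h2 X Y Z hX hZ
  have h6 := (h2 Z X Y hZ hY).symm
  refine ⟨⟨h3, h4⟩, ⟨h1 _ _ _, ?_, ?_⟩, ⟨h5, h6⟩, h1 _ _ _, ?_, ?_⟩ <;> rw [h1] <;>
    simp only [h3, h4, h5, h6]

lemma P_perm (X Y Z : L) : S.P X Z Y = -S.P X Y Z ∧ S.P X (S.φ Z) Y = -S.P X Y (S.φ Z) ∧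
    S.P X Z (S.φ Y) = -S.P X (S.φ Y) Z ∧ S.P X (S.φ Z) (S.φ Y) = -S.P X (S.φ Y) (S.φ Z) :=
  ⟨S.P_swap _ _ _, S.P_swap _ _ _, S.P_swap _ _ _, S.P_swap _ _ _⟩

/-- The cyclic identity, the derivative of hφ = −φh and the Lie derivative identity, at arguments
twisted by φ, form a linear system in the values of ∇h and of τ with one h inserted. -/
lemma g_T_h (X Y Z : L) (hX : S.g X S.ξ = 0) (hY : S.g Y S.ξ = 0) (hZ : S.g Z S.ξ = 0) :
    S.g (S.T X Y) (S.h Z) = 0 := by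
  refine eq_zero_of_natCast_mul two_ne_zero ?_
  have hφ (U : L) (hU : S.g U S.ξ = 0) : S.φ (S.φ U) = -U := by rw [φ_φ, hU]; simp
  have hh (U : L) : S.h (S.φ U) = -S.φ (S.h U) := by rw [h_φ, φ_h]
  have c1 := S.cyclic_P X Z (S.φ Y) hX hZ (S.g_φ_ξ _)
  have c2 := S.cyclic_P (S.φ Z) X Y (S.g_φ_ξ _) hX hY
  have c3 := S.cyclic_P (S.φ Z) (S.φ X) (S.φ Y) (S.g_φ_ξ _) (S.g_φ_ξ _) (S.g_φ_ξ _)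
  have c4 := S.cyclic_P Z Y (S.φ X) hZ hY (S.g_φ_ξ _)
  have b1 := S.P_φ Y (S.φ Z) (S.φ X) (S.g_φ_ξ _) (S.g_φ_ξ _)
  have b2 := S.P_φ (S.φ Y) (S.φ X) Z (S.g_φ_ξ _) hZ
  have f1 := S.LT_φ X (S.φ Z) Y (S.g_φ_ξ _) hY
  have f2 := S.LT_φ (S.φ X) (S.φ Z) (S.φ Y) (S.g_φ_ξ _) (S.g_φ_ξ _)
  rw [LT_eq_cyclic _ _ _ _ hX (S.g_φ_ξ _) hY,
    LT_eq_cyclic _ _ _ _ hX (S.g_φ_ξ _) (S.g_φ_ξ _)] at f1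
  rw [LT_eq_cyclic _ _ _ _ (S.g_φ_ξ _) (S.g_φ_ξ _) (S.g_φ_ξ _),
    LT_eq_cyclic _ _ _ _ (S.g_φ_ξ _) (S.g_φ_ξ _) (S.g_φ_ξ _)] at f2
  simp only [← φ_h, hh, hφ, hX, hY, hZ, g_φ_ξ, g_h_ξ, map_neg, AddMonoidHom.neg_apply,
    LinearMap.neg_apply, S.P_neg, S.g_T_φ, S.g_T_φ_left, S.g_T_perm X Y Z, S.g_T_perm (S.h X) Y Z,
    S.g_T_perm X (S.h Y) Z, S.g_T_perm X Y (S.h Z), S.P_perm X Y Z, S.P_perm (S.φ X) Y Z,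
    S.P_perm Y X Z, S.P_perm (S.φ Y) X Z, S.P_perm Z X Y, S.P_perm (S.φ Z) X Y]
    at c1 c2 c3 c4 b1 b2 f1 f2
  push_cast
  -- These coefficients eliminate all values of ∇h and the terms with h in the other slots, leaving
  -- twice the goal.
  linear_combination -c1 + 2 * b1 - c2 + c3 + f1 - f2 - 2 * b2 - c4

lemma h_hor_T {X Y : L} (hX : S.g X S.ξ = 0) (hY : S.g Y S.ξ = 0) :
    S.h (S.hor (S.T X Y)) = 0 := by
  refine S.ext_g fun Z ↦ ?_
  have hZ : S.h Z = S.h (S.hor Z) := by simp [hor, h_ξ]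
  rw [g_h, S.g_hor (by rw [g_h_ξ]), hZ, g_T_h _ _ _ _ hX hY (S.g_hor_ξ Z)]
  simp

/-- If hY = 0 and hZ = 0 then g((∇_X h)Y,Z) = 0 by skewness of h, so `cyclic_P` reduces to 3τ = 0.
-/
lemma g_T_of_h_eq_zero {X Y Z : L} (hX : S.g X S.ξ = 0) (hY : S.g Y S.ξ = 0)
    (hZ : S.g Z S.ξ = 0) (hX' : S.h X = 0) (hY' : S.h Y = 0) (hZ' : S.h Z = 0) :
    S.g (S.T X Y) Z = 0 := by
  have hP {X Y Z : L} (hY : S.h Y = 0) (hZ : S.h Z = 0) : S.P X Y Z = 0 := by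
    rw [P, hY, map_zero, zero_sub, map_neg, LinearMap.neg_apply, g_h, hZ]; simp
  have h1 := S.cyclic_P X Y Z hX hY hZ
  rw [hP hY' hZ', hP hZ' hX', hP hX' hY'] at h1
  exact eq_zero_of_natCast_mul three_ne_zero (by push_cast; linear_combination -h1)

lemma hor_T_of_h_eq_zero {X Y : L} (hX : S.g X S.ξ = 0) (hY : S.g Y S.ξ = 0)
    (hX' : S.h X = 0) (hY' : S.h Y = 0) : S.hor (S.T X Y) = 0 := by
  apply S.eq_zero_of_g_self
  rw [S.g_hor (S.g_hor_ξ _)]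
  exact S.g_T_of_h_eq_zero hX hY (S.g_hor_ξ _) hX' hY' (S.h_hor_T hX hY)

/-- The squared length of the horizontal part W of T(X,Y) is −g(T(X,W),Y), and W lies in ker h. -/
lemma hor_T_of_h_left_eq_zero {X Y : L} (hX : S.g X S.ξ = 0) (hY : S.g Y S.ξ = 0)
    (hX' : S.h X = 0) : S.hor (S.T X Y) = 0 := by
  apply S.eq_zero_of_g_self
  rw [S.g_hor (S.g_hor_ξ _), S.g_T_right, ← S.g_hor hY,
    S.hor_T_of_h_eq_zero hX (S.g_hor_ξ _) hX' (S.h_hor_T hX hY)]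
  simp

/-- On a nearly Sasakian manifold, `T` has no component on the distribution orthogonal to `ξ`. -/
lemma hor_T {X Y : L} (hX : S.g X S.ξ = 0) (hY : S.g Y S.ξ = 0) : S.hor (S.T X Y) = 0 := by
  apply S.eq_zero_of_g_self
  rw [S.g_hor (S.g_hor_ξ _), ← S.g_T_rotate, ← S.g_hor hY,
    S.hor_T_of_h_left_eq_zero (S.g_hor_ξ _) hX (S.h_hor_T hX hY)]
  simp

theorem T_eq (X Y : L) :
    S.T X Y = S.g X S.ξ • S.A Y - S.g Y S.ξ • S.A X - S.g X (S.A Y) • S.ξ := by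
  have h1 := S.hor_T (S.g_hor_ξ X) (S.g_hor_ξ Y)
  have h2 : S.T (S.hor X) (S.hor Y)
      = S.T X Y - S.g X S.ξ • S.A Y + S.g Y S.ξ • S.A X := by
    simp only [hor, map_sub, AddMonoidHom.sub_apply, map_smul, AddMonoidHom.smul_apply, T_smul,
      T_ξ, T_ξ_right, A_ξ]
    module
  have h3 : S.g (S.T X Y) S.ξ = -S.g X (S.A Y) := by
    rw [g_T_right, T_ξ_right, map_neg, LinearMap.neg_apply, g_A]; simp
  rw [h2] at h1
  simp only [hor, map_sub, map_add, map_smul, LinearMap.sub_apply, LinearMap.add_apply,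
    LinearMap.smul_apply, g_A_ξ, h3, smul_zero] at h1
  linear_combination (norm := module) h1

end NearlySasakianModule

noncomputable section

namespace RiemannianGeometry

/-! ### Smoothness of inverse matrices -/

section Matrix

variable {E : Type*} [NormedAddCommGroup E] [NormedSpace ℝ E]
  {H : Type*} [TopologicalSpace H] {I : ModelWithCorners ℝ E H}
  {M : Type*} [TopologicalSpace M] [ChartedSpace H M] {x : M}
  {ι : Type*} [Fintype ι] [DecidableEq ι] {A : M → Matrix ι ι ℝ}

lemma contMDiffAt_det
    (hA : ∀ i j, CMDiffAt ∞ (fun y ↦ A y i j) x) : CMDiffAt ∞ (fun y ↦ (A y).det) x := by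
  simp only [Matrix.det_apply, Units.smul_def, zsmul_eq_mul]
  exact contMDiffAt_finsetSum fun σ _ ↦ contMDiffAt_const.mul
    (contMDiffAt_finsetProd fun i _ ↦ hA _ _)

lemma contMDiffAt_matrix_inv
    (hA : ∀ i j, CMDiffAt ∞ (fun y ↦ A y i j) x) (h0 : (A x).det ≠ 0) (i j : ι) :
    CMDiffAt ∞ (fun y ↦ (A y)⁻¹ i j) x := by
  simp only [Matrix.inv_def, Matrix.smul_apply, smul_eq_mul, Ring.inverse_eq_inv',
    Matrix.adjugate_apply]
  refine ((contMDiffAt_det hA).inv₀ h0).mul (contMDiffAt_det fun k l ↦ ?_)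
  by_cases hk : k = j
  · subst hk; simpa using contMDiffAt_const
  · simpa [Matrix.updateRow_ne hk] using hA k l

end Matrix

/-! ### Smoothness of the Levi-Civita derivative -/

section Smoothness

variable {E : Type*} [NormedAddCommGroup E] [NormedSpace ℝ E]
  {H : Type*} [TopologicalSpace H] {I : ModelWithCorners ℝ E H}
  {M : Type*} [TopologicalSpace M] [ChartedSpace H M] [IsManifold I ∞ M]
  (g : ContMDiffRiemannianMetric I ∞ E (TangentSpace I : M → Type _))
  {X Y Z : Π x : M, TangentSpace I x} {f : M → ℝ} {x : M}

lemma contMDiffAt_mvfderiv_apply (hf : CMDiffAt ∞ f x) (hX : CMDiffAt ∞ (T% X) x) :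
    CMDiffAt ∞ (fun y ↦ d% f y (X y)) x := by
  have h1 := hf.mfderiv_const (m := ∞) (by simp)
  have h2 := ContMDiffAt.clm_apply_of_inCoordinates (b₁ := id) (b₂ := f) h1 hX hf
  exact (contMDiff_snd_tangentBundle_modelSpace ℝ 𝓘(ℝ, ℝ)).contMDiffAt.comp x h2

lemma contMDiffAt_pairing (hX : CMDiffAt ∞ (T% X) x) (hY : CMDiffAt ∞ (T% Y) x) :
    CMDiffAt ∞ (pairing g X Y) x := by
  have h := ContMDiffAt.clm_bundle_apply₂ (F₁ := E) (F₂ := E) (F₃ := ℝ)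
    (E₃ := Bundle.Trivial M ℝ) (g.contMDiff.contMDiffAt (x := x)) hX hY
  simp only [contMDiffAt_totalSpace] at h
  exact h.2

lemma eventually_mdifferentiableAt (hX : CMDiffAt ∞ (T% X) x) : ∀ᶠ y in 𝓝 x, MDiffAt (T% X) y :=
  -- Order 1 is used because finite order of smoothness at a point persists on a neighbourhood,
  -- while order ∞ need not.
  ((contMDiffAt_iff_contMDiffAt_nhds (n := 1) (by simp)).mp (hX.of_le (by simp))).mono
    fun _ hy ↦ hy.mdifferentiableAt (by simp)

variable [FiniteDimensional ℝ E]

lemma contMDiffAt_mlieBracket (hX : CMDiffAt ∞ (T% X) x) (hY : CMDiffAt ∞ (T% Y) x) :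
    CMDiffAt ∞ (T% (VectorField.mlieBracket I X Y)) x := by
  have : CompleteSpace E := FiniteDimensional.complete ℝ E
  have : IsManifold I ((⊤ : ℕ∞) + 1) M := by simpa
  have : IsManifold I (minSmoothness ℝ 2) M := by
    rw [minSmoothness_of_isRCLikeNormedField]; infer_instance
  exact ContMDiffAt.mlieBracket_vectorField (n := ⊤) (m := ⊤) hX hY (by simp)

lemma contMDiffAt_koszul (hX : CMDiffAt ∞ (T% X) x) (hY : CMDiffAt ∞ (T% Y) x)
    (hZ : CMDiffAt ∞ (T% Z) x) : CMDiffAt ∞ (koszul g X Y Z) x := by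
  refine contMDiffAt_const.mul ?_
  refine ((((ContMDiffAt.add ?_ ?_).sub ?_).add ?_).sub ?_).add ?_
  · exact contMDiffAt_mvfderiv_apply (contMDiffAt_pairing g hY hZ) hX
  · exact contMDiffAt_mvfderiv_apply (contMDiffAt_pairing g hZ hX) hY
  · exact contMDiffAt_mvfderiv_apply (contMDiffAt_pairing g hX hY) hZ
  · exact contMDiffAt_pairing g (contMDiffAt_mlieBracket hX hY) hZ
  · exact contMDiffAt_pairing g (contMDiffAt_mlieBracket hY hZ) hX
  · exact contMDiffAt_pairing g (contMDiffAt_mlieBracket hZ hX) hY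

/-- A vector field is smooth if its inner products with smooth vector fields are smooth. -/
lemma contMDiffAt_of_inner
    (h : ∀ Z : Π x : M, TangentSpace I x, CMDiffAt ∞ (T% Z) x → CMDiffAt ∞ (pairing g Y Z) x) :
    CMDiffAt ∞ (T% Y) x := by
  classical
  let e := trivializationAt E (TangentSpace I : M → Type _) x
  let b := Module.finBasis ℝ E
  let s := e.localFrame b
  have hx : x ∈ e.baseSet := mem_baseSet_trivializationAt E (TangentSpace I : M → Type _) x
  have hs i : CMDiffAt ∞ (T% (s i)) x := contMDiffAt_localFrame_of_mem ∞ e b i hx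
  let G (y : M) : Matrix _ _ ℝ := .of fun i j ↦ pairing g (s i) (s j) y
  have hG {y : M} (hy : y ∈ e.baseSet) : (G y).det ≠ 0 := by
    have h1 := (LinearMap.BilinForm.nondegenerate_iff_det_ne_zero (e.basisAt b hy)).mp
      (metricForm_nondegenerate g y)
    rwa [show G y = LinearMap.BilinForm.toMatrix (e.basisAt b hy) (metricForm g y) from ?_]
    ext i j
    simp [G, s, pairing, hy, metricForm, LinearMap.BilinForm.toMatrix_apply]
  -- The frame coefficients of Y are its inner products with the frame times the inverse Gram
  -- matrix.
  have h1 : CMDiffAt ∞ (T% (fun y ↦ ∑ i, (∑ j, pairing g Y (s j) y * (G y)⁻¹ j i) • s i y)) x :=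
    .sum_section fun i _ ↦ (contMDiffAt_finsetSum fun j _ ↦ (h _ (hs j)).mul
      (contMDiffAt_matrix_inv (fun k l ↦ contMDiffAt_pairing g (hs k) (hs l)) (hG hx) j i)
        ).smul_section (hs i)
  refine h1.congr_of_eventuallyEq ?_
  filter_upwards [e.open_baseSet.mem_nhds hx] with y hy
  congr 1
  let B := e.basisAt b hy
  have hB i : s i y = B i := by simp [s, hy, B]
  have h2 : Matrix.vecMul (B.repr (Y y)) (G y) = fun j ↦ pairing g Y (s j) y := by
    ext j
    have h3 := congrArg (fun v ↦ g.inner y v (B j)) (B.sum_repr (Y y))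
    simp only [map_sum, map_smul, sum_apply, smul_apply, smul_eq_mul] at h3
    simpa [Matrix.vecMul, dotProduct, G, pairing, hB] using h3
  have h3 : Matrix.vecMul (fun j ↦ pairing g Y (s j) y) (G y)⁻¹ = B.repr (Y y) := by
    rw [← h2, Matrix.vecMul_vecMul, Matrix.mul_nonsing_inv _ (isUnit_iff_ne_zero.mpr (hG hy)),
      Matrix.vecMul_one]
  conv_lhs => rw [← B.sum_repr (Y y)]
  refine Finset.sum_congr rfl fun i _ ↦ ?_
  rw [← h3, hB]
  rfl

/-- The Levi-Civita derivative of a smooth vector field along a smooth vector field is smooth. -/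
lemma contMDiffAt_leviCivita (hX : CMDiffAt ∞ (T% X) x) (hY : CMDiffAt ∞ (T% Y) x) :
    CMDiffAt ∞ (T% (fun y ↦ leviCivita g Y y (X y))) x := by
  refine contMDiffAt_of_inner g fun Z hZ ↦ ?_
  refine (contMDiffAt_koszul g hX hY hZ).congr_of_eventuallyEq ?_
  -- The Koszul formula is available only where the fields are differentiable, which holds near x.
  filter_upwards [eventually_mdifferentiableAt hX, eventually_mdifferentiableAt hY,
    eventually_mdifferentiableAt hZ] with y h1 h2 h3
  exact inner_leviCivitaFun g h1 h2 h3

end Smoothness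

/-! ### Smooth vector fields as an instance of the algebraic model -/

section SmoothModule

variable {E : Type*} [NormedAddCommGroup E] [NormedSpace ℝ E]
  {H : Type*} [TopologicalSpace H] {I : ModelWithCorners ℝ E H}
  {M : Type*} [TopologicalSpace M] [ChartedSpace H M] [IsManifold I ∞ M]

variable (I M) in
/-- The smooth vector fields on `M`. -/
abbrev SmoothVectorField : Type _ := Cₛ^∞⟮I; E, (TangentSpace I : M → Type _)⟯

/-- The product of a smooth vector field with a smooth function. -/
instance : SMul C^∞⟮I, M; 𝓘(ℝ, ℝ), ℝ⟯ (SmoothVectorField I M) :=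
  ⟨fun f X ↦ ⟨(f : M → ℝ) • ⇑X, f.contMDiff.smul_section X.contMDiff⟩⟩

/-- The smooth vector fields form a module over the ring of smooth functions. -/
instance : Module C^∞⟮I, M; 𝓘(ℝ, ℝ), ℝ⟯ (SmoothVectorField I M) where
  one_smul X := by ext x; exact one_smul ℝ (X x)
  mul_smul f g X := by ext x; exact mul_smul (f x) (g x) (X x)
  smul_zero f := by ext x; exact smul_zero (f x)
  smul_add f X Y := by ext x; exact smul_add (f x) (X x) (Y x)
  add_smul f g X := by ext x; exact add_smul (f x) (g x) (X x)
  zero_smul X := by ext x; exact zero_smul ℝ (X x)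

instance : IsAddTorsionFree C^∞⟮I, M; 𝓘(ℝ, ℝ), ℝ⟯ where
  nsmul_right_injective n hn f g h := by
    ext x
    have h1 : n • f x = n • g x := congrArg (fun f : C^∞⟮I, M; 𝓘(ℝ, ℝ), ℝ⟯ ↦ f x) h
    exact nsmul_right_injective hn h1

variable [FiniteDimensional ℝ E]
  (g : ContMDiffRiemannianMetric I ∞ E (TangentSpace I : M → Type _))

/-- The Levi-Civita connection on the module of smooth vector fields. -/
def smoothLeviCivita : SmoothVectorField I M →ₗ[C^∞⟮I, M; 𝓘(ℝ, ℝ), ℝ⟯]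
    SmoothVectorField I M →+ SmoothVectorField I M where
  toFun X := AddMonoidHom.mk' (fun Y ↦ ⟨fun x ↦ leviCivita g Y x (X x), fun x ↦
      contMDiffAt_leviCivita g X.contMDiff.contMDiffAt Y.contMDiff.contMDiffAt⟩)
    fun Y₁ Y₂ ↦ by
      ext x
      exact congrArg (· (X x)) ((leviCivita g).isCovariantDerivativeOnUniv.add
        Y₁.mdifferentiableAt Y₂.mdifferentiableAt)
  map_add' X₁ X₂ := by ext Y x; exact map_add (leviCivita g Y x) (X₁ x) (X₂ x)
  map_smul' f X := by ext Y x; exact map_smul (leviCivita g Y x) (f x) (X x)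

lemma coe_smoothLeviCivita_sub (X Y : SmoothVectorField I M) :
    ⇑(smoothLeviCivita g X Y - smoothLeviCivita g Y X) = VectorField.mlieBracket I X Y := by
  ext x
  exact leviCivita_torsion_free g X.mdifferentiableAt Y.mdifferentiableAt

/-- The smooth vector fields on a Riemannian manifold with the Levi-Civita connection. -/
def leviCivitaModule :
    LeviCivitaModule C^∞⟮I, M; 𝓘(ℝ, ℝ), ℝ⟯ (SmoothVectorField I M) where
  D X := AddMonoidHom.mk' (fun f ↦ ⟨fun x ↦ d% f x (X x), fun x ↦
      contMDiffAt_mvfderiv_apply f.contMDiff.contMDiffAt X.contMDiff.contMDiffAt⟩)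
    fun f₁ f₂ ↦ by
      ext x
      exact congrArg (· (X x)) (mvfderiv_add (f₁.contMDiff.mdifferentiable (by simp) x)
        (f₂.contMDiff.mdifferentiable (by simp) x))
  g := LinearMap.mk₂ _ (fun X Y ↦ ⟨pairing g X Y, fun x ↦
      contMDiffAt_pairing g X.contMDiff.contMDiffAt Y.contMDiff.contMDiffAt⟩)
    (fun X₁ X₂ Y ↦ by ext x; exact (metricForm g x).map_add₂ (X₁ x) (X₂ x) (Y x))
    (fun f X Y ↦ by ext x; exact (metricForm g x).map_smul₂ (f x) (X x) (Y x))
    (fun X Y₁ Y₂ ↦ by ext x; exact map_add (g.inner x (X x)) (Y₁ x) (Y₂ x))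
    (fun f X Y ↦ by ext x; exact map_smul (g.inner x (X x)) (f x) (Y x))
  nabla := smoothLeviCivita g
  g_comm X Y := by ext x; exact g.symm x _ _
  eq_zero_of_g_self X h := by
    ext x
    by_contra hx
    exact (g.pos x (X x) hx).ne' (congrArg (fun f : C^∞⟮I, M; 𝓘(ℝ, ℝ), ℝ⟯ ↦ f x) h)
  leibniz X f Y := by
    ext x
    have h := congrArg (· (X x)) ((leviCivita g).isCovariantDerivativeOnUniv.leibniz
      (Y.mdifferentiableAt (x := x)) (f.contMDiff.mdifferentiable (by simp) x))
    exact h.trans (add_comm _ _)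
  D_g X Y Z := by
    ext x
    exact leviCivita_metric g X.mdifferentiableAt Y.mdifferentiableAt Z.mdifferentiableAt
  jacobi X Y Z := by
    have : CompleteSpace E := FiniteDimensional.complete ℝ E
    have : IsManifold I (minSmoothness ℝ 3) M := by
      rw [minSmoothness_of_isRCLikeNormedField]; infer_instance
    have h2 : minSmoothness ℝ 2 ≤ ∞ := by
      rw [minSmoothness_of_isRCLikeNormedField]; exact WithTop.coe_le_coe.mpr le_top
    apply ContMDiffSection.coe_inj
    rw [ContMDiffSection.coe_add]
    simp only [coe_smoothLeviCivita_sub]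
    exact VectorField.leibniz_identity_mlieBracket (𝕜 := ℝ)
      (X.contMDiff.of_le h2) (Y.contMDiff.of_le h2) (Z.contMDiff.of_le h2)

namespace AlmostContactMetricStructure

variable (S : AlmostContactMetricStructure I M)

/-- The action of `φ` on smooth vector fields. -/
def smoothφ : SmoothVectorField I M →ₗ[C^∞⟮I, M; 𝓘(ℝ, ℝ), ℝ⟯] SmoothVectorField I M where
  toFun X := ⟨fun x ↦ S.φ x (X x), S.smooth_φ.clm_bundle_apply X.contMDiff⟩
  map_add' X Y := by ext x; exact map_add (S.φ x) (X x) (Y x)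
  map_smul' f X := by ext x; exact map_smul (S.φ x) (f x) (X x)

/-- The nearly Sasakian structure on the module of smooth vector fields. -/
def nearlySasakianModule (hS : S.IsNearlySasakian) :
    NearlySasakianModule C^∞⟮I, M; 𝓘(ℝ, ℝ), ℝ⟯ (SmoothVectorField I M) where
  toLeviCivitaModule := leviCivitaModule S.g
  φ := S.smoothφ
  ξ := ⟨S.ξ, S.smooth_ξ⟩
  φ_φ X := by
    ext x
    exact (S.φ_sq x (X x)).trans (by rw [S.η_eq]; rfl)
  g_ξ_ξ := by ext x; exact S.inner_ξ_ξ x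
  g_φ X Y := by ext x; exact S.φ_skew x _ _
  nearly X := by
    ext x
    exact (hS X X.contMDiff x).trans (by rw [S.η_eq]; rfl)

lemma covDerivEnd_eq (hS : S.IsNearlySasakian) (X Y : SmoothVectorField I M) (x : M) :
    covDerivEnd S.g S.φ X Y x = (S.nearlySasakianModule hS).T X Y x
      + S.g.inner x (X x) (Y x) • S.ξ x - S.η x (Y x) • X x := by
  rw [S.η_eq]
  exact congrArg (fun V : SmoothVectorField I M ↦ V x) (sub_eq_iff_eq_add.mpr <|
    ((S.nearlySasakianModule hS).nabla_φ X Y).trans (by abel) :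
    (S.nearlySasakianModule hS).nabla X ((S.nearlySasakianModule hS).φ Y) -
      (S.nearlySasakianModule hS).φ ((S.nearlySasakianModule hS).nabla X Y) =
      (S.nearlySasakianModule hS).T X Y
        + (S.nearlySasakianModule hS).g X Y • (S.nearlySasakianModule hS).ξ
        - (S.nearlySasakianModule hS).g Y (S.nearlySasakianModule hS).ξ • X)

/-- For X = ξ the two correction terms in T cancel, so A is ∇_ξφ itself. -/
lemma covDerivEnd_ξ (hS : S.IsNearlySasakian) (Y : SmoothVectorField I M) (x : M) :
    covDerivEnd S.g S.φ S.ξ Y x = (S.nearlySasakianModule hS).A Y x := by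
  have h : covDerivEnd S.g S.φ S.ξ Y x = (S.nearlySasakianModule hS).A Y x
      + S.g.inner x (S.ξ x) (Y x) • S.ξ x - S.η x (Y x) • S.ξ x :=
    S.covDerivEnd_eq hS ⟨S.ξ, S.smooth_ξ⟩ Y x
  rw [h, S.η_eq, S.g.symm x (S.ξ x), add_sub_cancel_right]

/-- The covariant derivative of `φ` on a nearly Sasakian manifold. -/
theorem covDerivEnd_eq_of_isNearlySasakian (hS : S.IsNearlySasakian)
    {X Y : Π x : M, TangentSpace I x} (hX : IsSmoothVectorField X) (hY : IsSmoothVectorField Y)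
    (x : M) :
    covDerivEnd S.g S.φ X Y x
      = S.g.inner x (X x) (Y x) • S.ξ x - S.η x (Y x) • X x
        + S.η x (X x) • covDerivEnd S.g S.φ S.ξ Y x
        - S.η x (Y x) • covDerivEnd S.g S.φ S.ξ X x
        - S.g.inner x (X x) (covDerivEnd S.g S.φ S.ξ Y x) • S.ξ x := by
  let N := S.nearlySasakianModule hS
  have h1 : covDerivEnd S.g S.φ X Y x = N.T ⟨X, hX⟩ ⟨Y, hY⟩ x
      + S.g.inner x (X x) (Y x) • S.ξ x - S.η x (Y x) • X x :=
    S.covDerivEnd_eq hS ⟨X, hX⟩ ⟨Y, hY⟩ x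
  have h2 : covDerivEnd S.g S.φ S.ξ X x = N.A ⟨X, hX⟩ x := S.covDerivEnd_ξ hS ⟨X, hX⟩ x
  have h3 : covDerivEnd S.g S.φ S.ξ Y x = N.A ⟨Y, hY⟩ x := S.covDerivEnd_ξ hS ⟨Y, hY⟩ x
  have h4 : N.T ⟨X, hX⟩ ⟨Y, hY⟩ x = S.η x (X x) • N.A ⟨Y, hY⟩ x - S.η x (Y x) • N.A ⟨X, hX⟩ x
      - S.g.inner x (X x) (N.A ⟨Y, hY⟩ x) • S.ξ x := by
    rw [N.T_eq, S.η_eq, S.η_eq]; rfl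
  rw [h1, h2, h3, h4]
  abel

end AlmostContactMetricStructure

end SmoothModule

end RiemannianGeometry

end

theorem mainTheorem2 (n : ℕ) {M : Type*} [TopologicalSpace M]
    [ChartedSpace (EuclideanSpace ℝ (Fin (2 * n + 1))) M]
    [IsManifold (𝓡 (2 * n + 1)) ∞ M] [T2Space M] [SecondCountableTopology M]
    (S : RiemannianGeometry.AlmostContactMetricStructure (𝓡 (2 * n + 1)) M)
    (hS : S.IsNearlySasakian) :
    (∀ X Y : Π x : M, TangentSpace (𝓡 (2 * n + 1)) x,
      RiemannianGeometry.IsSmoothVectorField X → RiemannianGeometry.IsSmoothVectorField Y →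
      ∀ x : M,
        RiemannianGeometry.covDerivEnd S.g S.φ X Y x
          = S.g.inner x (X x) (Y x) • S.ξ x - S.η x (Y x) • X x
            + S.η x (X x) • RiemannianGeometry.covDerivEnd S.g S.φ S.ξ Y x
            - S.η x (Y x) • RiemannianGeometry.covDerivEnd S.g S.φ S.ξ X x
            - S.g.inner x (X x) (RiemannianGeometry.covDerivEnd S.g S.φ S.ξ Y x) • S.ξ x) ∧
    (S.IsSasakian ↔
      ∀ Y : Π x : M, TangentSpace (𝓡 (2 * n + 1)) x, RiemannianGeometry.IsSmoothVectorField Y →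
        ∀ x : M, RiemannianGeometry.covDerivEnd S.g S.φ S.ξ Y x = 0) := by
  refine ⟨fun X Y hX hY x ↦ S.covDerivEnd_eq_of_isNearlySasakian hS hX hY x,
    fun h Y hY x ↦ ?_, fun h X Y hX hY x ↦ ?_⟩
  · rw [h S.ξ Y S.smooth_ξ hY, S.η_eq, S.g.symm x (S.ξ x), sub_self]
  · rw [S.covDerivEnd_eq_of_isNearlySasakian hS hX hY, h X hX, h Y hY]
    simp
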